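/- Let $r$ be an odd prime with $r \neq 5$, and let $G$ be a finite group whose Fitting subgroup $R := F(G)$ equals $O_r(G)$ (the largest normal $r$-subgroup of $G$) and such that $F^*(G/R) \cong \operatorname{Alt}(5)$, where $F^*$ denotes the generalized Fitting subgroup. If some element $x \in G$ of order $5$ acts fixed-point-freely on $R$ by conjugation, that is, $C_R(x) = 1$, then $R$ is nilpotent of class at most two. -/

import Mathlib

/-- The Fitting subgroup `F(G)`: the subgroup generated by all nilpotent normal subgroups of `G`
(for finite `G`, the largest nilpotent normal subgroup). -/
def fittingSubgroup (G : Type*) [Group G] : Subgroup G :=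
  sSup {N : Subgroup G | N.Normal ∧ Group.IsNilpotent N}

instance fittingSubgroup_normal (G : Type*) [Group G] : (fittingSubgroup G).Normal :=
  Subgroup.sSup_normal _ fun _ hN => hN.1

/-- `O_p(G)`: the subgroup generated by all normal `p`-subgroups of `G`
(for finite `G`, the largest normal `p`-subgroup). -/
def pCore (p : ℕ) (G : Type*) [Group G] : Subgroup G :=
  sSup {N : Subgroup G | N.Normal ∧ IsPGroup p N}

/-- A group is quasisimple if it is perfect and simple modulo its centre. -/
def IsQuasisimple (K : Type*) [Group K] : Prop :=
  Group.IsPerfect K ∧ IsSimpleGroup (K ⧸ Subgroup.center K)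

/-- The layer `E(G)`: the subgroup generated by all components of `G`, that is, by all subnormal
quasisimple subgroups. -/
def layer (G : Type*) [Group G] : Subgroup G :=
  sSup {K : Subgroup G | K.IsSubnormal ∧ IsQuasisimple K}

/-- The generalized Fitting subgroup `F*(G) = F(G) E(G)`. -/
def generalizedFittingSubgroup (G : Type*) [Group G] : Subgroup G :=
  fittingSubgroup G ⊔ layer G

/-! Each lower central factor of `R` is a module for `G/R`, hence for `Alt(5)`. Since `x` has no
nontrivial fixed point on `R`, the map `a ↦ a⁻¹ · xax⁻¹` permutes each lower central term, so every
element of a factor is of the form `x·a - a`, and the norm `1 + x + ⋯ + x⁴` telescopes to zero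
there. In characteristic zero this leaves only copies of the 4-dimensional deleted permutation
module, since every other irreducible module has a vector fixed by a 5-cycle. To cover `r = 3` and
factors of any exponent, character theory is replaced by two identities in the integral group ring,
`tri_klein_perm` and `involution_perm`. They give `five_nsmul_eq_sum`: up to the factor 5, every
vector is a sum of translates, indexed by the five points, of vectors fixed by a point stabilizer
`Alt(4)`. On such translates an equivariant bracket depends on one fixed vector
(`exists_bracket_translate`). The Jacobi identity then becomes a linear system of determinant 4, so
triple brackets vanish (`triple_bracket_eq_zero`). The third lower central term thus equals the
fourth, and is trivial by nilpotency. It remains to see that `xR` lies in `F*(G/R)`. This subgroup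
has trivial centre, hence trivial centralizer, so it has index at most two in `G/R` and contains
every element of order 5. -/

namespace AltFive

/-! ### Identities in the group ring of Alt(5) -/

/-- The 5-cycle `i ↦ i + 1` in `Alt(5)`. -/
def rot : alternatingGroup (Fin 5) :=
  ⟨finRotate 5, Equiv.Perm.mem_alternatingGroup.2 (by decide +kernel)⟩

/-- The 3-cycle `(2 3 4)` in `Alt(5)`. -/
def tri : alternatingGroup (Fin 5) :=
  ⟨Equiv.swap 2 3 * Equiv.swap 3 4, Equiv.Perm.mem_alternatingGroup.2 (by decide +kernel)⟩

/-- The double transposition `(1 2)(3 4)` in `Alt(5)`. -/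
def dbl : alternatingGroup (Fin 5) :=
  ⟨Equiv.swap 1 2 * Equiv.swap 3 4, Equiv.Perm.mem_alternatingGroup.2 (by decide +kernel)⟩

/-- The double transposition `(1 3)(2 4)` in `Alt(5)`. -/
def dbl' : alternatingGroup (Fin 5) :=
  ⟨Equiv.swap 1 3 * Equiv.swap 2 4, Equiv.Perm.mem_alternatingGroup.2 (by decide +kernel)⟩

/-- The elements of the Klein four-group of `Alt(5)` fixing the point `0`. -/
def klein : List (alternatingGroup (Fin 5)) := [1, dbl, dbl', dbl * dbl']

/-- The left coset `g ⟨h rot h⁻¹⟩`, as a list. -/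
def cosetList (g h : alternatingGroup (Fin 5)) : List (alternatingGroup (Fin 5)) :=
  (List.range 5).map fun k => g * (h * rot ^ k * h⁻¹)

theorem rot_pow_apply_zero : ∀ i : Fin 5, (rot ^ (i : ℕ) : alternatingGroup (Fin 5)).1 0 = i := by
  decide +kernel

theorem exists_map_zero_one : ∀ i j : Fin 5, i ≠ j →
    ∃ g : alternatingGroup (Fin 5), g.1 0 = i ∧ g.1 1 = j := by
  decide +kernel

theorem exists_fix_fix_move : ∀ i j k : Fin 5, i ≠ k → j ≠ k →
    ∃ g : alternatingGroup (Fin 5), g.1 i = i ∧ g.1 j = j ∧ k ≠ g.1 k := by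
  decide +kernel

theorem exists_tri_pow_mul : ∀ g : alternatingGroup (Fin 5), g.1 0 = 0 →
    ∃ k : Fin 3, ∃ v ∈ klein, g = tri ^ (k : ℕ) * v := by
  decide +kernel

theorem klein_perm : ∀ g : alternatingGroup (Fin 5), g.1 0 = 0 →
    (klein.map (· * g)).Perm (klein.map (g * ·)) := by
  decide +kernel

theorem klein_mul_perm : ∀ v ∈ klein, (klein.map (v * ·)).Perm klein := by
  decide +kernel

/-- With `V` the sum over the Klein group, this reads `(N₁ + N₂)V + 2·tri·V = (N₃ + N₄)V + 2V`,
where each `Nᵢ` is the sum over a coset of a Sylow 5-subgroup. Where 5-norms vanish, only `2·tri·V =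
2V` remains. -/
theorem tri_klein_perm :
    ((cosetList 1 1 ++ cosetList 1 dbl).flatMap (fun a => klein.map (a * ·)) ++
      (klein.map (tri * ·) ++ klein.map (tri * ·))).Perm
    ((cosetList tri tri ++ cosetList tri (tri * tri * dbl * (tri * tri))).flatMap
      (fun a => klein.map (a * ·)) ++ (klein ++ klein)) := by
  decide +kernel

/-- The involution `dbl * dbl'` inverts `rot`, so each of the six cosets consists of the five
involutions normalizing one Sylow 5-subgroup. Every involution inverts two Sylow 5-subgroups and
lies in one of the five Klein groups, so both sides equal ten identities plus twice the 15
involutions. -/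
theorem involution_perm :
    ([1, tri, tri * tri, dbl, dbl' * tri, dbl * (tri * tri)].flatMap (fun h =>
      cosetList (h * (dbl * dbl') * h⁻¹) h) ++ List.replicate 10 1).Perm
    ((List.range 5).flatMap (fun i => (klein ++ klein).map (fun v => rot ^ i * v * (rot ^ i)⁻¹))) := by
  decide +kernel

end AltFive

/-! ### Modules on which the norm of a 5-cycle vanishes -/

namespace AltFive

/-- A representation of `Alt(5)` on an abelian group without 2- or 5-torsion on which the norm of a
5-cycle vanishes. -/
structure NormFree {M : Type*} [AddCommGroup M]
    (ρ : alternatingGroup (Fin 5) →* AddMonoid.End M) : Prop where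
  norm_eq_zero : ∀ m, ∑ k ∈ Finset.range 5, ρ (rot ^ k) m = 0
  two_torsion : ∀ m : M, 2 • m = 0 → m = 0
  five_torsion : ∀ m : M, 5 • m = 0 → m = 0

section Rep

variable {M : Type*} [AddCommGroup M] (ρ : alternatingGroup (Fin 5) →* AddMonoid.End M)

/-- The trace over the Klein four-group fixing `0`. -/
def trace : M →+ M := (klein.map ρ).sum

theorem trace_apply (m : M) : trace ρ m = (klein.map fun v => ρ v m).sum := by
  simp [trace, klein]
  rfl

/-- The fixed points of the stabilizer of `0`. -/
def pointFixed : AddSubgroup M where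
  carrier := {m | ∀ g : alternatingGroup (Fin 5), g.1 0 = 0 → ρ g m = m}
  add_mem' := fun ha hb g hg => by rw [map_add, ha g hg, hb g hg]
  zero_mem' := fun g _ => map_zero _
  neg_mem' := fun ha g hg => by rw [map_neg, ha g hg]

/-- The translate of `u ∈ pointFixed ρ` associated with the point `i`. -/
def translate (i : Fin 5) : M →+ M := ρ (rot ^ (i : ℕ))

/-- The `i`-th coordinate of `m`, an element of `pointFixed ρ`. -/
def coord (i : Fin 5) : M →+ M := (trace ρ).comp (ρ (rot ^ (i : ℕ))⁻¹)

variable {ρ}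

theorem map_mul_apply (g h : alternatingGroup (Fin 5)) (m : M) : ρ (g * h) m = ρ g (ρ h m) := by
  rw [map_mul]; rfl

theorem map_inv_apply_map (g : alternatingGroup (Fin 5)) (m : M) : ρ g⁻¹ (ρ g m) = m := by
  rw [← map_mul_apply, inv_mul_cancel, map_one]; rfl

theorem map_apply_map_inv (g : alternatingGroup (Fin 5)) (m : M) : ρ g (ρ g⁻¹ m) = m := by
  rw [← map_mul_apply, mul_inv_cancel, map_one]; rfl

theorem sum_map_eq_of_perm {l l' : List (alternatingGroup (Fin 5))} (h : l.Perm l') (m : M) :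
    (l.map fun g => ρ g m).sum = (l'.map fun g => ρ g m).sum :=
  (h.map _).sum_eq

/-- The powers of `rot` represent the cosets of the stabilizer of `0`, and `rot^(-g i) * g * rot^i`
lies in that stabilizer. -/
theorem map_translate {u : M} (hu : u ∈ pointFixed ρ) (g : alternatingGroup (Fin 5)) (i : Fin 5) :
    ρ g (translate ρ i u) = translate ρ (g.1 i) u := by
  have h := hu ((rot ^ ((g.1 i : Fin 5) : ℕ))⁻¹ * g * rot ^ (i : ℕ)) (by
    have h1 := rot_pow_apply_zero i
    have h2 := rot_pow_apply_zero (g.1 i)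
    simp only [Subgroup.coe_mul, InvMemClass.coe_inv, Equiv.Perm.mul_apply] at *
    rw [h1, Equiv.Perm.inv_eq_iff_eq, h2])
  rw [map_mul_apply, map_mul_apply] at h
  have := congrArg (ρ (rot ^ ((g.1 i : Fin 5) : ℕ))) h
  rw [map_apply_map_inv] at this
  exact this

theorem translate_injective (i : Fin 5) : Function.Injective (translate ρ i) :=
  Function.LeftInverse.injective (g := ρ (rot ^ (i : ℕ))⁻¹) fun m => map_inv_apply_map _ m

theorem trace_map (m : M) {g : alternatingGroup (Fin 5)} (hg : g.1 0 = 0) :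
    trace ρ (ρ g m) = ρ g (trace ρ m) := by
  have h := sum_map_eq_of_perm (ρ := ρ) (klein_perm g hg) m
  simp only [List.map_map, Function.comp_def, map_mul_apply] at h
  rw [trace_apply, trace_apply, map_list_sum, List.map_map]
  exact h

theorem map_trace_of_mem (m : M) {v : alternatingGroup (Fin 5)} (hv : v ∈ klein) :
    ρ v (trace ρ m) = trace ρ m := by
  have h := sum_map_eq_of_perm (ρ := ρ) (klein_mul_perm v hv) m
  simp only [List.map_map, Function.comp_def, map_mul_apply] at h
  rw [trace_apply, map_list_sum, List.map_map]
  exact h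

theorem sum_flatMap {ι : Type*} (l : List ι)
    (f : ι → List (alternatingGroup (Fin 5))) (m : M) :
    ((l.flatMap f).map fun g => ρ g m).sum = (l.map fun a => ((f a).map fun g => ρ g m).sum).sum := by
  induction l with
  | nil => rfl
  | cons a l ih => simp [ih]

namespace NormFree

variable (hρ : NormFree ρ)
include hρ

theorem sum_cosetList (g h : alternatingGroup (Fin 5)) (m : M) :
    ((cosetList g h).map fun a => ρ a m).sum = 0 := by
  have h1 := congrArg (fun m => ρ g (ρ h m)) (hρ.norm_eq_zero (ρ h⁻¹ m))
  simp only [map_sum, map_zero, ← map_mul_apply] at h1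
  rw [← h1, cosetList, List.map_map, ← List.sum_toFinset _ List.nodup_range, List.toFinset_range]
  simp [Function.comp_def, mul_assoc]

theorem map_tri_trace (m : M) : ρ tri (trace ρ m) = trace ρ m := by
  have h := sum_map_eq_of_perm (ρ := ρ) tri_klein_perm m
  have hk (a : alternatingGroup (Fin 5)) :
      ((klein.map (a * ·)).map fun g => ρ g m).sum = ρ a (trace ρ m) := by
    rw [trace_apply, map_list_sum, List.map_map, List.map_map]
    simp only [Function.comp_def, map_mul_apply]
  simp only [List.map_append, List.sum_append, sum_flatMap, hk, hρ.sum_cosetList, zero_add,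
    ← trace_apply] at h
  rw [← sub_eq_zero]
  refine hρ.two_torsion _ ?_
  rw [two_nsmul, sub_add_sub_comm, h, sub_self]

/-- The stabilizer `Alt(4)` of `0` is generated by the Klein group and `tri`, and both fix the
trace. -/
theorem trace_mem (m : M) : trace ρ m ∈ pointFixed ρ := by
  intro g hg
  obtain ⟨k, v, hv, rfl⟩ := exists_tri_pow_mul g hg
  rw [map_mul_apply, map_trace_of_mem m hv]
  generalize (k : ℕ) = n
  induction n with
  | zero => rw [pow_zero, map_one]; rfl
  | succ n ih => rw [pow_succ, map_mul_apply, hρ.map_tri_trace, ih]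

theorem coord_mem (i : Fin 5) (m : M) : coord ρ i m ∈ pointFixed ρ := hρ.trace_mem _

theorem coord_map (m : M) (g : alternatingGroup (Fin 5)) (i : Fin 5) :
    coord ρ (g.1 i) (ρ g m) = coord ρ i m := by
  have hk : ((rot ^ ((g.1 i : Fin 5) : ℕ))⁻¹ * g * rot ^ (i : ℕ)).1 0 = 0 := by
    have h1 := rot_pow_apply_zero i
    have h2 := rot_pow_apply_zero (g.1 i)
    simp only [Subgroup.coe_mul, InvMemClass.coe_inv, Equiv.Perm.mul_apply] at *
    rw [h1, Equiv.Perm.inv_eq_iff_eq, h2]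
  have h := trace_map (ρ := ρ) (ρ (rot ^ (i : ℕ))⁻¹ m) hk
  rw [hρ.trace_mem _ _ hk, ← map_mul_apply, mul_assoc, mul_inv_cancel, mul_one, map_mul_apply] at h
  exact h

theorem sum_translate (u : M) : ∑ i, translate ρ i u = 0 := by
  rw [← hρ.norm_eq_zero u, Finset.sum_range]; rfl

/-- Once the coset sums vanish, `involution_perm` says `10 m` is twice the sum of the traces over
the five Klein groups. -/
theorem five_nsmul_eq_sum (m : M) : 5 • m = ∑ i, translate ρ i (coord ρ i m) := by
  have h := sum_map_eq_of_perm (ρ := ρ) involution_perm m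
  simp only [List.map_append, List.sum_append, sum_flatMap, hρ.sum_cosetList, List.map_replicate,
    List.sum_replicate, List.map_const', smul_zero, zero_add, map_one, AddMonoid.End.coe_one, id] at h
  have hi (n : ℕ) : ((klein.map (fun v => rot ^ n * v * (rot ^ n)⁻¹)).map fun g => ρ g m).sum =
      ρ (rot ^ n) (trace ρ (ρ (rot ^ n)⁻¹ m)) := by
    rw [trace_apply, map_list_sum, List.map_map, List.map_map]
    simp only [Function.comp_def, map_mul_apply]
  simp only [hi, ← two_nsmul] at h
  rw [← sub_eq_zero]
  refine hρ.two_torsion _ ?_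
  rw [smul_sub, smul_smul]
  change 10 • m - _ = 0
  rw [h, ← List.sum_toFinset _ List.nodup_range, List.toFinset_range, Finset.sum_range,
    ← Finset.smul_sum, sub_eq_zero]
  rfl

/-- If translates to three points sum to zero, one of them being different from the other two,
then the corresponding fixed point vanishes. -/
theorem eq_zero_of_translate_add {a b c : M} (ha : a ∈ pointFixed ρ) (hb : b ∈ pointFixed ρ)
    (hc : c ∈ pointFixed ρ) {i j k : Fin 5} (hik : i ≠ k) (hjk : j ≠ k)
    (h : translate ρ i a + translate ρ j b + translate ρ k c = 0) : c = 0 := by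
  -- Applying `g` and comparing shows that two distinct translates of `c` agree. By double
  -- transitivity all five agree, and they sum to zero.
  obtain ⟨g, hi, hj, hk⟩ := exists_fix_fix_move i j k hik hjk
  have h1 := congrArg (ρ g) h
  rw [map_add, map_add, map_zero, map_translate ha, map_translate hb, map_translate hc, hi, hj,
    ← h, add_right_inj] at h1
  obtain ⟨g', h0', h1'⟩ := exists_map_zero_one _ _ hk
  rw [← h1', ← h0', ← map_translate hc, ← map_translate hc] at h1
  have h01 : translate ρ 0 c = translate ρ 1 c := by
    rw [← map_inv_apply_map (ρ := ρ) g' (translate ρ 0 c), ← h1, map_inv_apply_map]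
  have h0 (n : Fin 5) : translate ρ n c = translate ρ 0 c := by
    by_cases hn : n = 0
    · rw [hn]
    · obtain ⟨g, h0, h1⟩ := exists_map_zero_one 0 n (Ne.symm hn)
      have := congrArg (ρ g) h01
      rw [map_translate hc, map_translate hc, h0, h1] at this
      exact this.symm
  have hs := hρ.sum_translate c
  simp only [h0, Finset.sum_const, Finset.card_univ, Fintype.card_fin] at hs
  exact translate_injective (ρ := ρ) 0 (by rw [hρ.five_torsion _ hs, map_zero])

end NormFree

end Rep

/-! ### Equivariant brackets and the Jacobi identity -/

section Bracket

variable {A B C : Type*} [AddCommGroup A] [AddCommGroup B] [AddCommGroup C]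
  {α : alternatingGroup (Fin 5) →* AddMonoid.End A}
  {β : alternatingGroup (Fin 5) →* AddMonoid.End B}
  {γ : alternatingGroup (Fin 5) →* AddMonoid.End C}

/-- An equivariant biadditive map is determined on translates of fixed points by a single
fixed point. -/
theorem exists_bracket_translate (hα : NormFree α) (hβ : NormFree β) (hγ : NormFree γ)
    (f : A →+ B →+ C) (hf : ∀ g a b, f (α g a) (β g b) = γ g (f a b))
    {a : A} {b : B} (ha : a ∈ pointFixed α) (hb : b ∈ pointFixed β) :
    ∃ p ∈ pointFixed γ,
      (∀ i j, i ≠ j → 5 • f (translate α i a) (translate β j b) =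
        translate γ i p + translate γ j p) ∧
      ∀ i, 5 • f (translate α i a) (translate β i b) + 3 • translate γ i p = 0 := by
  have hg (g : alternatingGroup (Fin 5)) (i j : Fin 5) :
      γ g (f (translate α i a) (translate β j b)) =
        f (translate α (g.1 i) a) (translate β (g.1 j) b) := by
    rw [← hf, map_translate ha, map_translate hb]
  set c := f (translate α 0 a) (translate β 1 b) with hc
  -- `tri` fixes `0` and `1` and permutes `2, 3, 4` cyclically, so the last three coordinates of `c`
  -- coincide.
  have htri : γ tri c = c := hg tri 0 1
  have hcoord (i : Fin 5) : coord γ (tri.1 i) c = coord γ i c := by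
    rw [← hγ.coord_map c tri i, htri]
  have h3 : coord γ 3 c = coord γ 2 c := hcoord 2
  have h4 : coord γ 4 c = coord γ 2 c := (hcoord 3).trans h3
  obtain ⟨p, hp, q, hq, hpq⟩ : ∃ p ∈ pointFixed γ, ∃ q ∈ pointFixed γ,
      5 • c = translate γ 0 p + translate γ 1 q := by
    -- Subtracting the vanishing sum of all translates of `coord γ 2 c` removes the points `2, 3,
    -- 4`.
    refine ⟨coord γ 0 c - coord γ 2 c, sub_mem (hγ.coord_mem _ _) (hγ.coord_mem _ _),
      coord γ 1 c - coord γ 2 c, sub_mem (hγ.coord_mem _ _) (hγ.coord_mem _ _), ?_⟩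
    have h := hγ.sum_translate (coord γ 2 c)
    rw [← sub_zero (5 • c), ← h, hγ.five_nsmul_eq_sum c, Fin.sum_univ_five, Fin.sum_univ_five,
      h3, h4, map_sub, map_sub]
    abel
  have hne (i j : Fin 5) (hij : i ≠ j) : 5 • f (translate α i a) (translate β j b) =
      translate γ i p + translate γ j q := by
    obtain ⟨g, h0, h1⟩ := exists_map_zero_one i j hij
    have := congrArg (γ g) hpq
    rw [map_nsmul, map_add, map_translate hp, map_translate hq, hc, hg, h0, h1] at this
    exact this
  -- Summing over either argument gives `x - p₀ + 4q₀ = 0` and `x + 4p₀ - q₀ = 0`. Hence `5p₀ =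
  -- 5q₀`, and then `x = -3p₀`.
  have hA := congrArg (fun x => 5 • f x (translate β 0 b)) (hα.sum_translate a)
  have hB := congrArg (fun x => 5 • f (translate α 0 a) x) (hβ.sum_translate b)
  have hP := hγ.sum_translate p
  have hQ := hγ.sum_translate q
  simp only [Fin.sum_univ_five, map_add, AddMonoidHom.add_apply, smul_add, map_zero,
    AddMonoidHom.zero_apply, smul_zero] at hA hB hP hQ
  rw [hne 1 0 (by decide), hne 2 0 (by decide), hne 3 0 (by decide), hne 4 0 (by decide)] at hA
  rw [hne 0 1 (by decide), hne 0 2 (by decide), hne 0 3 (by decide), hne 0 4 (by decide)] at hB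
  set x := 5 • f (translate α 0 a) (translate β 0 b) with hx
  have hpq0 : translate γ 0 p = translate γ 0 q := by
    rw [← sub_eq_zero]
    refine hγ.five_torsion _ ?_
    linear_combination (norm := module) hB - hA + hP - hQ
  obtain rfl := translate_injective _ hpq0
  refine ⟨p, hp, hne, fun i => ?_⟩
  have h0 : x + 3 • translate γ 0 p = 0 := by
    linear_combination (norm := module) hB - hP
  have := congrArg (γ (rot ^ (i : ℕ))) h0
  rw [hx, map_add, map_nsmul, hg, map_nsmul, map_translate hp, rot_pow_apply_zero, map_zero] at this
  exact this

/-- In a graded Lie ring whose homogeneous components of degree one, two and three are norm-free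
representations of `Alt(5)`, triple products of elements of degree one vanish. -/
theorem triple_bracket_eq_zero (hα : NormFree α) (hβ : NormFree β) (hγ : NormFree γ)
    (f : A →+ A →+ B) (hf : ∀ g a b, f (α g a) (α g b) = β g (f a b))
    (f' : B →+ A →+ C) (hf' : ∀ g a b, f' (β g a) (α g b) = γ g (f' a b))
    (jacobi : ∀ a b c, f' (f a b) c + f' (f b c) a + f' (f c a) b = 0) (a b c : A) :
    f' (f a b) c = 0 := by
  have main {u v w : A} (hu : u ∈ pointFixed α) (hv : v ∈ pointFixed α) (hw : w ∈ pointFixed α)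
      (i j k : Fin 5) :
      f' (f (translate α i u) (translate α j v)) (translate α k w) = 0 := by
    obtain ⟨p, hp, hp1, hp2⟩ := exists_bracket_translate hα hα hβ f hf hu hv
    obtain ⟨q, hq, hq1, -⟩ := exists_bracket_translate hα hα hβ f hf hv hw
    obtain ⟨s, hs, hs1, -⟩ := exists_bracket_translate hα hα hβ f hf hw hu
    obtain ⟨p', hp', hp1', hp2'⟩ := exists_bracket_translate hβ hα hγ f' hf' hp hw
    obtain ⟨q', hq', hq1', -⟩ := exists_bracket_translate hβ hα hγ f' hf' hq hu
    obtain ⟨s', hs', hs1', -⟩ := exists_bracket_translate hβ hα hγ f' hf' hs hv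
    have e {x : B} {y z : B} {d : A} (h : 5 • x = y + z) :
        25 • f' x d = 5 • f' y d + 5 • f' z d := by
      rw [← smul_add, ← AddMonoidHom.add_apply, ← map_add, ← h, map_nsmul,
        AddMonoidHom.nsmul_apply, smul_smul]
      rfl
    -- At three distinct points every bracket is of the off-diagonal kind. The factor 25 clears the
    -- 5 of both brackets.
    have J := congrArg (25 • ·) (jacobi (translate α 0 u) (translate α 1 v) (translate α 2 w))
    simp only [smul_add, smul_zero] at J
    rw [e (hp1 0 1 (by decide)), e (hq1 1 2 (by decide)), e (hs1 2 0 (by decide)),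
      hp1' 0 2 (by decide), hp1' 1 2 (by decide), hq1' 1 0 (by decide), hq1' 2 0 (by decide),
      hs1' 2 1 (by decide), hs1' 0 1 (by decide)] at J
    have J0 : translate γ 0 (p' + 2 • q' + s') + translate γ 1 (p' + q' + 2 • s') +
        translate γ 2 (2 • p' + q' + s') = 0 := by
      simp only [map_add, map_nsmul]
      linear_combination (norm := module) J
    have m1 : p' + 2 • q' + s' ∈ pointFixed γ :=
      add_mem (add_mem hp' (nsmul_mem hq' _)) hs'
    have m2 : p' + q' + 2 • s' ∈ pointFixed γ :=
      add_mem (add_mem hp' hq') (nsmul_mem hs' _)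
    have m3 : 2 • p' + q' + s' ∈ pointFixed γ :=
      add_mem (add_mem (nsmul_mem hp' _) hq') hs'
    have z3 := hγ.eq_zero_of_translate_add m1 m2 m3 (by decide) (by decide) J0
    have z2 := hγ.eq_zero_of_translate_add m1 m3 m2 (i := 0) (j := 2) (k := 1) (by decide)
      (by decide) (by rw [← J0]; abel)
    have z1 := hγ.eq_zero_of_translate_add m2 m3 m1 (i := 1) (j := 2) (k := 0) (by decide)
      (by decide) (by rw [← J0]; abel)
    -- The system with 2 on the diagonal and 1 elsewhere has determinant 4; this combination
    -- isolates `4p'`.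
    have hp0 : p' = 0 := by
      refine hγ.two_torsion _ (hγ.two_torsion _ ?_)
      linear_combination (norm := module) 3 • z3 - z2 - z1
    have hz (i k : Fin 5) : 5 • f' (translate β i p) (translate α k w) = 0 := by
      by_cases hik : i = k
      · subst hik
        simpa [hp0] using hp2' i
      · rw [hp1' i k hik, hp0]; simp
    refine hγ.five_torsion _ (hγ.five_torsion _ ?_)
    rw [smul_smul]
    change 25 • _ = (0 : C)
    by_cases hij : i = j
    · subst hij
      have := congrArg (fun x => 5 • f' x (translate α k w)) (hp2 i)
      simp only [map_add, map_nsmul, AddMonoidHom.add_apply, AddMonoidHom.nsmul_apply, smul_add,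
        map_zero, AddMonoidHom.zero_apply, smul_zero] at this
      rw [smul_comm 5 3, hz, smul_zero, add_zero, smul_smul] at this
      exact this
    · rw [e (hp1 i j hij), hz, hz, add_zero]
  -- One factor 5 for each argument, so that all three become sums of translates.
  refine hγ.five_torsion _ (hγ.five_torsion _ (hγ.five_torsion _ ?_))
  have h : 5 • 5 • 5 • f' (f a b) c = f' (f (5 • a) (5 • b)) (5 • c) := by
    simp only [map_nsmul, AddMonoidHom.nsmul_apply]
  rw [h, hα.five_nsmul_eq_sum a, hα.five_nsmul_eq_sum b, hα.five_nsmul_eq_sum c]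
  simp only [map_sum, AddMonoidHom.finsetSum_apply, main (hα.coord_mem _ _) (hα.coord_mem _ _)
    (hα.coord_mem _ _), Finset.sum_const_zero]

end Bracket

end AltFive

/-! ### The graded Lie ring of the lower central series -/

namespace LowerCentral

open scoped commutatorElement

variable (R : Type*) [Group R]

/-- The `n`-th term of the lower central series of `R`, starting with `R` for `n = 0`. -/
abbrev term (n : ℕ) : Subgroup R := (⊤ : Subgroup R).lowerCentralSeries n

/-- The `n`-th factor of the lower central series. -/
abbrev Factor (n : ℕ) : Type _ := term R n ⧸ (term R (n + 1)).subgroupOf (term R n)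

variable {R}

theorem commutator_mem_term {n : ℕ} {a : R} (ha : a ∈ term R n) (b : R) : ⁅a, b⁆ ∈ term R (n + 1) :=
  Subgroup.commutator_mem_commutator ha (Subgroup.mem_top b)

theorem factor_mk_eq_iff {n : ℕ} {a b : term R n} :
    (a : Factor R n) = b ↔ ((a : R) : R ⧸ term R (n + 1)) = (b : R) := by
  rw [QuotientGroup.eq, QuotientGroup.eq]; rfl

theorem commute_mk {n : ℕ} {a : R} (ha : a ∈ term R n) (q : R ⧸ term R (n + 1)) :
    (a : R ⧸ term R (n + 1)) * q = q * a := by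
  obtain ⟨b, rfl⟩ := QuotientGroup.mk_surjective q
  rw [← commutatorElement_eq_one_iff_mul_comm]
  exact (QuotientGroup.eq_one_iff _).2 (commutator_mem_term ha b)

instance (n : ℕ) : CommGroup (Factor R n) :=
  { (inferInstance : Group (Factor R n)) with
    mul_comm := by
      rintro ⟨a⟩ ⟨b⟩
      exact factor_mk_eq_iff.2 (commute_mk a.2 (b : R)) }

/-- The commutator map on representatives. -/
def bracketRep (n : ℕ) (a : term R n) (b : term R 0) : Factor R (n + 1) :=
  QuotientGroup.mk (s := (term R (n + 1 + 1)).subgroupOf (term R (n + 1)))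
    ⟨⁅(a : R), (b : R)⁆, commutator_mem_term a.2 b⟩

theorem bracketRep_mul_right (n : ℕ) (a : term R n) (b c : term R 0) :
    bracketRep n a (b * c) = bracketRep n a b * bracketRep n a c := by
  refine factor_mk_eq_iff.2 ?_
  change ((⁅(a : R), (b : R) * c⁆ : R) : R ⧸ term R (n + 1 + 1)) =
    (⁅(a : R), (b : R)⁆ : R) * (⁅(a : R), (c : R)⁆ : R)
  have h := commute_mk (commutator_mem_term a.2 (c : R)) (b : R)
  rw [commutatorElement_mul_right_eq_mul_conj]
  simp only [QuotientGroup.mk_mul, QuotientGroup.mk_inv, mul_assoc] at h ⊢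
  rw [← mul_assoc ((b : R) : R ⧸ term R (n + 1 + 1)), ← h, mul_inv_cancel_right]

theorem bracketRep_mul_left (n : ℕ) (a b : term R n) (c : term R 0) :
    bracketRep n (a * b) c = bracketRep n a c * bracketRep n b c := by
  refine factor_mk_eq_iff.2 ?_
  change ((⁅(a : R) * b, (c : R)⁆ : R) : R ⧸ term R (n + 1 + 1)) =
    (⁅(a : R), (c : R)⁆ : R) * (⁅(b : R), (c : R)⁆ : R)
  have h := commute_mk (commutator_mem_term b.2 (c : R)) (a : R)
  rw [commutatorElement_mul_left_eq_conj_mul]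
  simp only [QuotientGroup.mk_mul, QuotientGroup.mk_inv]
  rw [← h, mul_inv_cancel_right, commute_mk (commutator_mem_term b.2 (c : R))]

/-- The commutator map with one factor fixed. -/
def bracketRight (n : ℕ) (a : term R n) : Factor R 0 →* Factor R (n + 1) :=
  QuotientGroup.lift _ (MonoidHom.mk' (bracketRep n a) (bracketRep_mul_right n a)) <| by
    intro b hb
    let φ : R →* Factor R (n + 1) :=
      (MonoidHom.mk' (bracketRep n a) (bracketRep_mul_right n a)).comp
        Subgroup.topEquiv.symm.toMonoidHom
    have h : (b : R) ∈ φ.ker := Abelianization.commutator_subset_ker φ hb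
    exact h

/-- The commutator map of the associated graded Lie ring with the second argument in degree one. -/
def bracket (n : ℕ) : Factor R n →* Factor R 0 →* Factor R (n + 1) :=
  QuotientGroup.lift _ (MonoidHom.mk' (bracketRight n) fun a b => by
    refine MonoidHom.ext ?_
    rintro ⟨c⟩
    exact bracketRep_mul_left n a b c) <| by
  intro a ha
  refine MonoidHom.ext ?_
  rintro ⟨b⟩
  exact factor_mk_eq_iff.2 ((QuotientGroup.eq_one_iff _).2 (commutator_mem_term (n := n + 1) ha b))

theorem bracket_jacobi (a b c : Factor R 0) :
    bracket 1 (bracket 0 a b) c * bracket 1 (bracket 0 b c) a * bracket 1 (bracket 0 c a) b = 1 := by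
  obtain ⟨a, rfl⟩ := QuotientGroup.mk_surjective a
  obtain ⟨b, rfl⟩ := QuotientGroup.mk_surjective b
  obtain ⟨c, rfl⟩ := QuotientGroup.mk_surjective c
  -- Representatives in the shape of the Hall–Witt identity; the conjugation by `y` is invisible in
  -- the abelian factor `Factor R 0`.
  let t (x y z : term R 0) : term R 2 :=
    ⟨⁅⁅(x : R), (y : R)⁆, (y : R) * z * (y : R)⁻¹⁆,
      commutator_mem_term (commutator_mem_term x.2 _) _⟩
  have ht (x y z : term R 0) : bracket 1 (bracket 0 (x : Factor R 0) (y : Factor R 0))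
      (z : Factor R 0) = (t x y z : Factor R 2) := by
    have hz : (z : Factor R 0) = y * z * (y : Factor R 0)⁻¹ := by
      rw [mul_comm (y : Factor R 0), mul_inv_cancel_right]
    exact congrArg (bracket 1 _) hz
  rw [ht, ht, ht]
  exact (factor_mk_eq_iff (a := t a b c * t b c a * t c a b) (b := 1)).2
    (congrArg _ (commutatorElement_commutatorElement_conj_mul (a : R) b c))

/-- The additive version of `bracket`. -/
def addBracket (n : ℕ) :
    Additive (Factor R n) →+ Additive (Factor R 0) →+ Additive (Factor R (n + 1)) :=
  AddMonoidHom.mk' (fun a => (bracket n a.toMul).toAdditive) fun a b => by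
    refine AddMonoidHom.ext fun c => ?_
    exact congrArg (fun f : Factor R 0 →* Factor R (n + 1) => Additive.ofMul (f c.toMul))
      (map_mul (bracket n) a.toMul b.toMul)

theorem apply_mem_term (σ : MulAut R) {n : ℕ} {a : R} (ha : a ∈ term R n) : σ a ∈ term R n :=
  (Subgroup.characteristic_iff_le_comap.1 inferInstance σ : term R n ≤ _) ha

/-- The action of an automorphism on a factor of the lower central series. -/
def factorMap (n : ℕ) (σ : MulAut R) : Factor R n →* Factor R n :=
  QuotientGroup.map _ _
    ((σ.toMonoidHom.comp (term R n).subtype).codRestrict (term R n) fun a => apply_mem_term σ a.2)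
    fun a ha => apply_mem_term (n := n + 1) (a := (a : R)) σ ha

/-- The representation of the automorphism group on a factor of the lower central series. -/
def factorRep (n : ℕ) : MulAut R →* AddMonoid.End (Additive (Factor R n)) where
  toFun σ := (factorMap n σ).toAdditive
  map_one' := by ext ⟨a⟩; rfl
  map_mul' σ τ := by ext ⟨a⟩; rfl

theorem addBracket_factorRep (n : ℕ) (σ : MulAut R) (a : Additive (Factor R n))
    (b : Additive (Factor R 0)) :
    addBracket n (factorRep n σ a) (factorRep 0 σ b) = factorRep (n + 1) σ (addBracket n a b) := by
  obtain ⟨a⟩ := a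
  obtain ⟨b⟩ := b
  change bracketRep n ⟨σ a, _⟩ ⟨σ b, _⟩ = factorMap (n + 1) σ (bracketRep n a b)
  refine factor_mk_eq_iff.2 ?_
  exact congrArg _ (map_commutatorElement σ (a : R) b).symm

end LowerCentral

/-! ### The action of the quotient on the lower central factors -/

namespace LowerCentral

open AltFive

open scoped commutatorElement

theorem term_two_eq_bot_of_bracket_eq_one {R : Type*} [Group R] [Group.IsNilpotent R]
    (h : ∀ a b c : Factor R 0, bracket 1 (bracket 0 a b) c = 1) : term R 2 = ⊥ := by
  have h1 : term R 1 ≤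
      (((bracket 1).ker.comap (QuotientGroup.mk' _)).map (term R 1).subtype : Subgroup R) := by
    refine Subgroup.commutator_le.2 fun a ha b _ => ?_
    refine ⟨⟨⁅a, b⁆, commutator_mem_term ha b⟩, ?_, rfl⟩
    exact MonoidHom.ext fun c => h ((⟨a, ha⟩ : term R 0) : Factor R 0)
      ((⟨b, Subgroup.mem_top b⟩ : term R 0) : Factor R 0) c
  -- The series is stationary from here on, so nilpotency makes it trivial.
  have h2 : term R 2 ≤ term R 3 := by
    refine Subgroup.commutator_le.2 fun a ha b hb => ?_
    obtain ⟨a', ha', rfl⟩ := h1 ha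
    have := DFunLike.congr_fun (MonoidHom.mem_ker.1 (Subgroup.mem_comap.1 ha'))
      ((⟨b, hb⟩ : term R 0) : Factor R 0)
    exact (QuotientGroup.eq_one_iff _).1 (factor_mk_eq_iff.1 this)
  have h3 (k : ℕ) : term R 2 ≤ term R (2 + k) := by
    induction k with
    | zero => exact le_rfl
    | succ k ih => exact h2.trans (Subgroup.commutator_mono ih le_rfl)
  obtain ⟨n, hn⟩ := Subgroup.nilpotent_iff_lowerCentralSeries.1 ‹Group.IsNilpotent R›
  rw [eq_bot_iff, ← hn]
  exact (h3 n).trans (Subgroup.lowerCentralSeries_antitone _ (Nat.le_add_left n 2))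

theorem nsmul_eq_zero_of_isPGroup {A : Type*} [CommGroup A] {p q : ℕ} (hA : IsPGroup p A)
    (hpq : p.Coprime q) {a : Additive A} (ha : q • a = 0) : a = 0 :=
  (hA.powEquiv hpq).injective (a₁ := a.toMul) (a₂ := 1)
    ((show a.toMul ^ q = 1 from ha).trans (one_pow q).symm)

section Action

variable {G : Type*} [Group G] (N : Subgroup G) [N.Normal]

/-- Each factor is central in `N` modulo the next term. This lets the action of `G` descend to `G ⧸
N`. -/
theorem factorRep_conjNormal_of_mem (n : ℕ) {s : G} (hs : s ∈ N) :
    factorRep n (MulAut.conjNormal s : MulAut N) = 1 := by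
  refine AddMonoidHom.ext fun a => ?_
  obtain ⟨a, rfl⟩ := QuotientGroup.mk_surjective a
  refine factor_mk_eq_iff.2 ?_
  have h := commute_mk a.2 ((⟨s, hs⟩ : N) : N ⧸ term N (n + 1))
  have e : ((MulAut.conjNormal s : MulAut N) a : N) = ⟨s, hs⟩ * a * (⟨s, hs⟩ : N)⁻¹ := rfl
  change (((MulAut.conjNormal s : MulAut N) a : N) : N ⧸ term N (n + 1)) = _
  rw [e, QuotientGroup.mk_mul, QuotientGroup.mk_mul, ← h, QuotientGroup.mk_inv,
    mul_inv_cancel_right]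

/-- The representation of `G ⧸ N` on a factor of the lower central series of `N`. -/
def quotientRep (n : ℕ) : G ⧸ N →* AddMonoid.End (Additive (Factor N n)) :=
  QuotientGroup.lift N ((factorRep n).comp MulAut.conjNormal) fun _ hs =>
    factorRep_conjNormal_of_mem N n hs

theorem addBracket_quotientRep (n : ℕ) (g : G ⧸ N) (a : Additive (Factor N n))
    (b : Additive (Factor N 0)) :
    addBracket n (quotientRep N n g a) (quotientRep N 0 g b) =
      quotientRep N (n + 1) g (addBracket n a b) := by
  obtain ⟨g, rfl⟩ := QuotientGroup.mk_surjective g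
  exact addBracket_factorRep n (MulAut.conjNormal g) a b

variable {N}

/-- Counting is done in the lower central term itself, where `a ↦ a⁻¹ · xax⁻¹` is injective and
hence surjective. No coprimeness is needed to pass to the factor. -/
theorem exists_eq_sub_of_fixedPointFree [Finite N] {x : G}
    (hfix : ∀ g ∈ N, x * g * x⁻¹ = g → g = 1) (n : ℕ) (m : Additive (Factor N n)) :
    ∃ a, m = quotientRep N n (x : G ⧸ N) a - a := by
  obtain ⟨c, hc⟩ := QuotientGroup.mk_surjective (Additive.toMul m)
  obtain rfl : Additive.ofMul (c : Factor N n) = m := hc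
  let σ : MulAut N := MulAut.conjNormal x
  have hinj : Function.Injective
      fun a : term N n => a⁻¹ * (⟨σ a, apply_mem_term σ a.2⟩ : term N n) := by
    intro a b hab
    have h : (a : N)⁻¹ * σ a = (b : N)⁻¹ * σ b := congrArg Subtype.val hab
    have h1 : σ ((a : N) * (b : N)⁻¹) = (a : N) * (b : N)⁻¹ := by
      rw [map_mul, map_inv, ← mul_inv_cancel_left (a : N) (σ a), h]
      group
    have h2 := hfix _ ((a : N) * (b : N)⁻¹).2 (congrArg Subtype.val h1)
    exact Subtype.ext (mul_inv_eq_one.1 (Subtype.ext h2))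
  obtain ⟨a, ha⟩ := Finite.injective_iff_surjective.1 hinj c
  refine ⟨Additive.ofMul (QuotientGroup.mk a : Factor N n), ?_⟩
  rw [sub_eq_neg_add, ← ha]
  rfl

theorem normFree_quotientRep [Finite N] {r : ℕ} (hr : r.Prime) (hr2 : r ≠ 2) (hr5 : r ≠ 5)
    (hN : IsPGroup r N) {x : G} (hfix : ∀ g ∈ N, x * g * x⁻¹ = g → g = 1)
    (e : alternatingGroup (Fin 5) →* G ⧸ N) (hx : e rot = x) (n : ℕ) :
    NormFree ((quotientRep N n).comp e) where
  norm_eq_zero m := by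
    obtain ⟨a, rfl⟩ := exists_eq_sub_of_fixedPointFree hfix n m
    have h5 : rot ^ 5 = 1 := by decide +kernel
    have h (k : ℕ) : ((quotientRep N n).comp e) (rot ^ k) (quotientRep N n (x : G ⧸ N) a - a) =
        ((quotientRep N n).comp e) (rot ^ (k + 1)) a - ((quotientRep N n).comp e) (rot ^ k) a := by
      rw [map_sub, pow_succ, map_mul_apply, ← hx]
      rfl
    rw [Finset.sum_congr rfl fun k _ => h k,
      Finset.sum_range_sub fun k => ((quotientRep N n).comp e) (rot ^ k) a, h5, pow_zero, sub_self]
  two_torsion m := nsmul_eq_zero_of_isPGroup ((hN.to_subgroup _).to_quotient _)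
    ((Nat.coprime_primes hr Nat.prime_two).2 hr2)
  five_torsion m := nsmul_eq_zero_of_isPGroup ((hN.to_subgroup _).to_quotient _)
    ((Nat.coprime_primes hr Nat.prime_five).2 hr5)

/-- A normal `r`-subgroup, `r ≠ 2, 5`, is nilpotent of class at most two if a 5-cycle in a subgroup
`Alt(5)` of the factor group lifts to an element acting fixed-point-freely. -/
theorem term_two_eq_bot_of_fixedPointFree [Finite N] {r : ℕ} (hr : r.Prime) (hr2 : r ≠ 2)
    (hr5 : r ≠ 5) (hN : IsPGroup r N) {x : G} (hfix : ∀ g ∈ N, x * g * x⁻¹ = g → g = 1)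
    (e : alternatingGroup (Fin 5) →* G ⧸ N) (hx : e rot = x) : term N 2 = ⊥ := by
  have : Fact r.Prime := ⟨hr⟩
  have : Group.IsNilpotent N := hN.isNilpotent
  have hρ := normFree_quotientRep hr hr2 hr5 hN hfix e hx
  exact term_two_eq_bot_of_bracket_eq_one fun a b c =>
    triple_bracket_eq_zero (hρ 0) (hρ 1) (hρ 2) (addBracket 0)
      (fun g => addBracket_quotientRep N 0 (e g)) (addBracket 1)
      (fun g => addBracket_quotientRep N 1 (e g)) bracket_jacobi a b c

end Action

end LowerCentral

/-! ### Subnormal subgroups and the generalized Fitting subgroup -/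

theorem IsQuasisimple.of_mulEquiv {K L : Type*} [Group K] [Group L] (e : K ≃* L)
    (hK : IsQuasisimple K) : IsQuasisimple L := by
  have := hK.1
  refine ⟨Group.IsPerfect.ofSurjective (f := e.toMonoidHom) e.surjective, ?_⟩
  refine (QuotientGroup.congr (Subgroup.center K) (Subgroup.center L) e ?_).isSimpleGroup_congr.1 hK.2
  ext l
  change l ∈ Subgroup.map e.toMonoidHom _ ↔ _
  rw [Subgroup.mem_map_equiv, Subgroup.mem_center_iff, Subgroup.mem_center_iff]
  refine ⟨fun h a => ?_, fun h a => ?_⟩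
  · simpa using congrArg e (h (e.symm a))
  · simpa using congrArg e.symm (h (e a))

instance layer_normal (H : Type*) [Group H] : (layer H).Normal := by
  refine ⟨fun n hn g => ?_⟩
  have h : (layer H).map (MulAut.conj g).toMonoidHom ≤ layer H := by
    rw [Subgroup.map_le_iff_le_comap]
    refine sSup_le fun K hK => Subgroup.map_le_iff_le_comap.1 (le_sSup (show _ ∧ _ from ⟨?_, ?_⟩))
    · exact hK.1.map (f := (MulAut.conj g).toMonoidHom) (MulAut.conj g).surjective
    · exact hK.2.of_mulEquiv
        (K.equivMapOfInjective (MulAut.conj g).toMonoidHom (MulAut.conj g).injective)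
  exact h ⟨n, hn, rfl⟩

instance generalizedFittingSubgroup_normal (H : Type*) [Group H] : (generalizedFittingSubgroup H).Normal :=
  Subgroup.sup_normal _ _

section Subnormal

variable {H : Type*} [Group H] [Finite H]

theorem Subgroup.relIndex_dvd_index_of_normal_right (Q K : Subgroup H) [K.Normal] :
    Q.relIndex K ∣ Q.index := by
  have h1 := Subgroup.relIndex_mul_relIndex (Q ⊓ K) Q (Q ⊔ K) inf_le_left le_sup_left
  have h2 := Subgroup.relIndex_mul_relIndex (Q ⊓ K) K (Q ⊔ K) inf_le_right le_sup_right
  rw [← h2, Subgroup.inf_relIndex_left, Subgroup.inf_relIndex_right, Subgroup.relIndex_sup_right,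
    mul_comm (Q.relIndex K)] at h1
  rw [← Nat.eq_of_mul_eq_mul_left (Nat.pos_of_ne_zero Subgroup.index_ne_zero_of_finite) h1]
  exact Subgroup.relIndex_dvd_index_of_le le_sup_left

/-- Descend along the subnormal chain: at each normal step the new index divides the previous one.
-/
theorem Subgroup.IsSubnormal.not_dvd_relIndex_sylow {p : ℕ} [Fact p.Prime] {K : Subgroup H}
    (hK : K.IsSubnormal) (P : Sylow p H) : ¬ p ∣ (P : Subgroup H).relIndex K := by
  induction hK with
  | top => rw [Subgroup.relIndex_top_right]; exact P.not_dvd_index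
  | step K L hKL _ hN ih =>
    refine fun h => ih (h.trans ?_)
    rw [← Subgroup.relIndex_subgroupOf hKL]
    exact Subgroup.relIndex_dvd_index_of_normal_right _ _

/-- A subnormal `p`-subgroup is contained in every Sylow `p`-subgroup. -/
theorem IsPGroup.le_sylow_of_isSubnormal {p : ℕ} [Fact p.Prime] {K : Subgroup H}
    (hp : IsPGroup p K) (hK : K.IsSubnormal) (P : Sylow p H) : K ≤ P := by
  rw [← Subgroup.relIndex_eq_one]
  obtain ⟨n, hn⟩ := hp.index ((P : Subgroup H).subgroupOf K)
  have h := hK.not_dvd_relIndex_sylow P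
  rw [Subgroup.relIndex, hn] at h ⊢
  cases n with
  | zero => rfl
  | succ n => exact absurd (dvd_pow_self p n.succ_ne_zero) h

/-- Lying in every Sylow `p`-subgroup, `K` has all its conjugates in a single one, so its normal
closure is a `p`-group. -/
theorem le_fittingSubgroup_of_isSubnormal {p : ℕ} [Fact p.Prime] {K : Subgroup H}
    (hp : IsPGroup p K) (hK : K.IsSubnormal) : K ≤ fittingSubgroup H := by
  have hle (P : Sylow p H) : K ≤ (P : Subgroup H) := hp.le_sylow_of_isSubnormal hK P
  let P : Sylow p H := Classical.arbitrary _
  have hP : Subgroup.normalClosure (K : Set H) ≤ P := by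
    rw [Subgroup.normalClosure, Subgroup.closure_le]
    intro g hg
    obtain ⟨k, hk, hkg⟩ := Group.mem_conjugatesOfSet_iff.1 hg
    obtain ⟨c, rfl⟩ := isConj_iff.1 hkg
    have := hle (c⁻¹ • P) hk
    rw [Sylow.coe_subgroup_smul] at this
    have := Subgroup.mem_inv_pointwise_smul_iff.1 (by simpa using this)
    exact this
  have hPn : IsPGroup p (Subgroup.normalClosure (K : Set H)) := P.isPGroup'.to_le hP
  refine Subgroup.subset_normalClosure.trans ?_
  exact le_sSup (a := Subgroup.normalClosure (K : Set H)) ⟨inferInstance, hPn.isNilpotent⟩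

/-- A nontrivial normal subgroup contains a simple subnormal subgroup. -/
theorem exists_isSimpleGroup_isSubnormal {C : Subgroup H} [hC : C.Normal] (hne : C ≠ ⊥) :
    ∃ S ≤ C, S.IsSubnormal ∧ IsSimpleGroup S := by
  obtain ⟨S, ⟨hSC, hS, hS1⟩, hmin⟩ := (Set.toFinite
    {S : Subgroup H | S ≤ C ∧ S.IsSubnormal ∧ S ≠ ⊥}).exists_minimal
      ⟨C, le_rfl, hC.isSubnormal, hne⟩
  refine ⟨S, hSC, hS, ?_⟩
  have : Nontrivial S := (Subgroup.nontrivial_iff_ne_bot S).2 hS1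
  refine ⟨fun N hN => ?_⟩
  by_cases hb : N = ⊥
  · exact Or.inl hb
  · right
    have hle : N.map S.subtype ≤ S := Subgroup.map_subtype_le N
    have h : S ≤ N.map S.subtype := hmin
      ⟨hle.trans hSC, hN.isSubnormal.trans' hS, fun h => hb ?_⟩ hle
    · rw [eq_top_iff]
      intro s _
      obtain ⟨t, ht, hts⟩ := h s.2
      rwa [← Subtype.ext hts]
    · rwa [Subgroup.map_eq_bot_iff_of_injective _ S.subtype_injective] at h

/-- An abelian `S` has prime order and falls into the Fitting subgroup; a nonabelian one is a
component. -/
theorem le_generalizedFittingSubgroup_of_isSimpleGroup {S : Subgroup H} (hS : S.IsSubnormal)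
    [IsSimpleGroup S] : S ≤ generalizedFittingSubgroup H := by
  by_cases hc : ∀ a b : S, a * b = b * a
  · let _ : CommGroup S := { (inferInstance : Group S) with mul_comm := hc }
    have hp : (Nat.card S).Prime := IsSimpleGroup.prime_card
    have : Fact (Nat.card S).Prime := ⟨hp⟩
    exact (le_fittingSubgroup_of_isSubnormal (IsPGroup.of_card (n := 1) (pow_one _).symm) hS).trans
      le_sup_left
  · refine le_trans (b := layer H) (le_sSup
      (show S.IsSubnormal ∧ IsQuasisimple S from ⟨hS, ⟨?_⟩, ?_⟩)) le_sup_right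
    · refine ((inferInstance : (commutator S).Normal).eq_bot_or_eq_top).resolve_left fun h => hc ?_
      intro a b
      rw [← commutatorElement_eq_one_iff_mul_comm, ← Subgroup.mem_bot, ← h]
      exact Subgroup.commutator_mem_commutator (Subgroup.mem_top a) (Subgroup.mem_top b)
    · have hz : Subgroup.center S = ⊥ := by
        refine ((inferInstance : (Subgroup.center S).Normal).eq_bot_or_eq_top).resolve_right
          fun h => hc fun a b => ?_
        exact (Subgroup.mem_center_iff.1 (h ▸ Subgroup.mem_top b) a)
      exact ((QuotientGroup.quotientMulEquivOfEq hz).trans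
        QuotientGroup.quotientBot).isSimpleGroup_congr.2 inferInstance

/-- If the generalized Fitting subgroup has trivial centre, then its centralizer is trivial. -/
theorem centralizer_generalizedFittingSubgroup_eq_bot
    (hc : Subgroup.center (generalizedFittingSubgroup H) = ⊥) :
    Subgroup.centralizer (generalizedFittingSubgroup H : Set H) = ⊥ := by
  by_contra hne
  obtain ⟨S, hSC, hS, hS'⟩ := exists_isSimpleGroup_isSubnormal hne
  have hSA := le_generalizedFittingSubgroup_of_isSimpleGroup hS
  obtain ⟨s, hs⟩ := exists_ne (1 : S)
  refine hs (Subtype.ext ?_)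
  have : (⟨s, hSA s.2⟩ : generalizedFittingSubgroup H) ∈
      Subgroup.center (generalizedFittingSubgroup H) :=
    Subgroup.mem_center_iff.2 fun a => Subtype.ext (hSC s.2 a a.2)
  rw [hc, Subgroup.mem_bot] at this
  have h1 := congrArg Subtype.val this
  exact h1

end Subnormal

/-! ### Finite groups with a self-centralizing-type normal subgroup Alt(5) -/

namespace AltFive

/-- The Klein four-group of `Alt(5)` fixing the point `0`. -/
def kleinSubgroup : Subgroup (alternatingGroup (Fin 5)) where
  carrier := {g | g ∈ klein}
  mul_mem' {a b} ha hb := by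
    have h : ∀ a ∈ klein, ∀ b ∈ klein, a * b ∈ klein := by decide +kernel
    exact h a ha b hb
  one_mem' := by
    change (1 : alternatingGroup (Fin 5)) ∈ klein
    decide +kernel
  inv_mem' {a} ha := by
    have h : ∀ a ∈ klein, a⁻¹ ∈ klein := by decide +kernel
    exact h a ha

theorem card_alternatingGroup_five : Nat.card (alternatingGroup (Fin 5)) = 60 := by
  rw [nat_card_alternatingGroup, Nat.card_eq_fintype_card, Fintype.card_fin]
  decide

theorem card_kleinSubgroup : Nat.card kleinSubgroup = 4 := by
  have h : klein.Nodup := by decide +kernel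
  exact (Nat.card_congr (Equiv.subtypeEquivRight fun g => (List.mem_toFinset).symm)).trans
    ((Nat.card_eq_fintype_card).trans ((Fintype.card_coe _).trans (List.toFinset_card_of_nodup h)))

/-- The Klein four-group as a Sylow subgroup. -/
def kleinSylow : Sylow 2 (alternatingGroup (Fin 5)) :=
  (IsPGroup.of_card (n := 2) card_kleinSubgroup).toSylow fun h => by
    have h1 := kleinSubgroup.card_mul_index
    rw [card_kleinSubgroup, card_alternatingGroup_five] at h1
    omega

/-- The normalizer of the Klein group contains the point stabilizer, of order 12. -/
theorem card_sylow_two_le : Nat.card (Sylow 2 (alternatingGroup (Fin 5))) ≤ 5 := by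
  rw [kleinSylow.card_eq_index_normalizer]
  set N := Subgroup.normalizer (kleinSylow : Set (alternatingGroup (Fin 5)))
  have hN : 12 ≤ Nat.card N := by
    have hs : ∀ g : alternatingGroup (Fin 5), g.1 0 = 0 → g ∈ N := by
      intro g hg
      refine Subgroup.mem_normalizer_iff.2 fun v => ⟨fun hv => ?_, fun hv => ?_⟩
      · obtain ⟨w, hw, hwg⟩ := List.mem_map.1 ((klein_perm g hg).mem_iff.2 (List.mem_map_of_mem hv))
        rw [← hwg, mul_inv_cancel_right]
        exact hw
      · obtain ⟨w, hw, hwg⟩ := List.mem_map.1 ((klein_perm g hg).mem_iff.1 (List.mem_map_of_mem hv))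
        rw [inv_mul_cancel_right, mul_right_inj] at hwg
        exact hwg ▸ hw
    have hc : Fintype.card {g : alternatingGroup (Fin 5) // g.1 0 = 0} = 12 := by decide +kernel
    rw [← hc, ← Nat.card_eq_fintype_card]
    exact Nat.card_le_card_of_injective
      (fun g : {g : alternatingGroup (Fin 5) // g.1 0 = 0} => (⟨g.1, hs g.1 g.2⟩ : N))
      fun a b h => Subtype.ext (congrArg (fun x : N => x.1) h)
  have h := N.card_mul_index
  rw [card_alternatingGroup_five] at h
  nlinarith

theorem exists_conj_eq_rot (g : alternatingGroup (Fin 5)) (hg : g ^ 5 = 1) (hg1 : g ≠ 1) :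
    ∃ c : Equiv.Perm (Fin 5), c * g.1 * c⁻¹ = rot.1 := by
  have : Fact (Nat.Prime 5) := ⟨Nat.prime_five⟩
  have h5 : orderOf g.1 = 5 := by
    rw [Subgroup.orderOf_coe]
    exact orderOf_eq_prime hg hg1
  have hc : g.1.IsCycle :=
    Equiv.Perm.isCycle_of_prime_order'' (by simpa using Nat.prime_five) (by simpa using h5)
  have hr : rot.1.IsCycle := isCycle_finRotate
  refine isConj_iff.1 ((hc.isConj_iff hr).2 ?_)
  rw [← hc.orderOf, h5]
  exact (congrArg Finset.card (support_finRotate (n := 3))).symm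

open scoped Pointwise in
/-- A finite group acting faithfully by conjugation on a normal subgroup `Alt(5)` has this subgroup
of index at most two. -/
theorem index_dvd_two {H : Type*} [Group H] [Finite H] (A : Subgroup H) [A.Normal]
    (e : A ≃* alternatingGroup (Fin 5)) (hA : Subgroup.centralizer (A : Set H) = ⊥) :
    A.index ∣ 2 := by
  let c : H →* MulAut (alternatingGroup (Fin 5)) :=
    (MulAut.congr e).toMonoidHom.comp MulAut.conjNormal
  let Φ : H →* Equiv.Perm (Sylow 2 (alternatingGroup (Fin 5))) :=
    (MulAction.toPermHom (MulAut (alternatingGroup (Fin 5))) _).comp c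
  have hc (a : A) : c a = MulAut.conj (e a) := by
    refine MulEquiv.ext fun b => ?_
    change e (MulAut.conjNormal (a : H) (e.symm b)) = e a * b * (e a)⁻¹
    rw [MulAut.conjNormal_val, MulAut.conj_apply, map_mul, map_mul, map_inv, e.apply_symm_apply]
  -- `A` is simple and moves its Sylow 2-subgroups, so the kernel meets it trivially. Two disjoint
  -- normal subgroups commute, which puts the kernel in the centralizer of `A`.
  have hdisj : Disjoint Φ.ker A := by
    let L : Subgroup (alternatingGroup (Fin 5)) := Φ.ker.comap (A.subtype.comp e.symm.toMonoidHom)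
    rcases (inferInstance : L.Normal).eq_bot_or_eq_top with hL | hL
    · rw [Subgroup.disjoint_def]
      intro x hx hxA
      have : e ⟨x, hxA⟩ ∈ L := by
        change Φ (e.symm (e ⟨x, hxA⟩) : A) = 1
        rw [e.symm_apply_apply]
        exact hx
      rw [hL, Subgroup.mem_bot, map_eq_one_iff e e.injective] at this
      exact congrArg Subtype.val this
    · exfalso
      have hn : (kleinSylow : Subgroup (alternatingGroup (Fin 5))).Normal := by
        rw [← Subgroup.normalizer_eq_top_iff, eq_top_iff]
        intro g _
        refine Sylow.smul_eq_iff_mem_normalizer.1 ?_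
        have hg : g ∈ L := hL ▸ Subgroup.mem_top g
        have h := DFunLike.congr_fun (show Φ (e.symm g : A) = 1 from hg) kleinSylow
        have h' : c (e.symm g : A) • kleinSylow = kleinSylow := h
        rw [hc, e.apply_symm_apply] at h'
        exact h'
      have h4 : Nat.card (kleinSylow : Subgroup (alternatingGroup (Fin 5))) = 4 := card_kleinSubgroup
      rcases hn.eq_bot_or_eq_top with h | h
      · rw [h, Subgroup.card_bot] at h4
        omega
      · rw [h, Subgroup.card_top, card_alternatingGroup_five] at h4
        omega
  have hker : Φ.ker = ⊥ := by
    rw [eq_bot_iff, ← hA]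
    intro k hk
    rw [Subgroup.mem_centralizer_iff]
    exact fun a ha => (Subgroup.commute_of_normal_of_disjoint _ _ inferInstance inferInstance hdisj
      k a hk ha).symm
  have hcard : Nat.card H ∣ 120 := by
    refine (Subgroup.card_dvd_of_injective Φ ((MonoidHom.ker_eq_bot_iff _).1 hker)).trans ?_
    rw [Nat.card_perm]
    exact Nat.factorial_dvd_factorial card_sylow_two_le
  rw [← A.card_mul_index, Nat.card_congr e.toEquiv, card_alternatingGroup_five] at hcard
  exact Nat.dvd_of_mul_dvd_mul_left (k := 60) (by norm_num) hcard

/-- Index at most two puts `x²` in `A`, and `x = x⁶ = (x²)³`. -/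
theorem mem_of_pow_five_eq_one {H : Type*} [Group H] [Finite H] (A : Subgroup H) [A.Normal]
    (e : A ≃* alternatingGroup (Fin 5)) (hA : Subgroup.centralizer (A : Set H) = ⊥) {x : H}
    (hx : x ^ 5 = 1) : x ∈ A := by
  obtain ⟨k, hk⟩ := index_dvd_two A e hA
  have h2 : x ^ 2 ∈ A := by
    rw [hk, pow_mul]
    exact pow_mem (A.pow_index_mem x) k
  have : x = (x ^ 2) ^ 3 := by
    rw [← pow_mul, pow_succ x 5, hx, one_mul]
  rw [this]
  exact pow_mem h2 3

/-- An element of order five of a normal subgroup `Alt(5)` is the image of `rot` under a suitable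
embedding of `Alt(5)`. -/
theorem exists_hom_rot_eq {H : Type*} [Group H] (A : Subgroup H)
    (e : A ≃* alternatingGroup (Fin 5)) {x : H} (hxA : x ∈ A) (hx : x ^ 5 = 1) (hx1 : x ≠ 1) :
    ∃ f : alternatingGroup (Fin 5) →* H, f rot = x := by
  obtain ⟨c, hc⟩ := exists_conj_eq_rot (e ⟨x, hxA⟩)
    (by rw [← map_pow, map_eq_one_iff e e.injective]; exact Subtype.ext hx)
    (by rw [Ne, map_eq_one_iff e e.injective]; exact fun h => hx1 (congrArg Subtype.val h))
  -- The 5-cycles form two classes in `Alt(5)` but one in `Sym(5)`, so the embedding is twisted by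
  -- conjugation with a possibly odd permutation.
  refine ⟨A.subtype.comp (e.symm.toMonoidHom.comp
    (MulAut.conjNormal c⁻¹ : MulAut (alternatingGroup (Fin 5))).toMonoidHom), ?_⟩
  have : (MulAut.conjNormal c⁻¹ : MulAut (alternatingGroup (Fin 5))) rot = e ⟨x, hxA⟩ := by
    refine Subtype.ext ?_
    rw [MulAut.conjNormal_apply, ← hc]
    group
  change ((e.symm ((MulAut.conjNormal c⁻¹ : MulAut (alternatingGroup (Fin 5))) rot) : A) : H) = x
  rw [this, e.symm_apply_apply]

end AltFive

/-! ### The main theorem -/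

theorem theorem3p1 (r : ℕ) (hr : r.Prime) (hr_odd : Odd r) (hr5 : r ≠ 5)
    (G : Type*) [Group G] [Finite G]
    (hF : fittingSubgroup G = pCore r G)
    (hFstar : Nonempty
      (generalizedFittingSubgroup (G ⧸ fittingSubgroup G) ≃* alternatingGroup (Fin 5)))
    (hfix : ∃ x : G, orderOf x = 5 ∧ ∀ g ∈ fittingSubgroup G, x * g * x⁻¹ = g → g = 1) :
    Group.IsNilpotent (fittingSubgroup G) ∧
      Group.nilpotencyClass (fittingSubgroup G) ≤ 2 := by
  have : Fact r.Prime := ⟨hr⟩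
  obtain ⟨e⟩ := hFstar
  obtain ⟨x, hx, hfix⟩ := hfix
  have hp : IsPGroup r (fittingSubgroup G) := by
    rw [hF]
    exact Sylow.sSup_of_normal _ (fun _ h => h.2) fun _ h => h.1
  have hnil : Group.IsNilpotent (fittingSubgroup G) := hp.isNilpotent
  refine ⟨hnil, Subgroup.lowerCentralSeries_eq_bot_iff_nilpotencyClass_le.1 ?_⟩
  have hcenter : Subgroup.center (generalizedFittingSubgroup (G ⧸ fittingSubgroup G)) = ⊥ := by
    have h5 := alternatingGroup.center_eq_bot (α := Fin 5) (by simp)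
    rw [eq_bot_iff]
    intro a ha
    have : e a ∈ Subgroup.center (alternatingGroup (Fin 5)) :=
      (Subgroup.centerCongr e ⟨a, ha⟩).2
    rwa [h5, Subgroup.mem_bot, map_eq_one_iff e e.injective] at this
  have hx5 : (x : G ⧸ fittingSubgroup G) ^ 5 = 1 := by
    rw [← QuotientGroup.mk_pow, ← hx, pow_orderOf_eq_one]; rfl
  -- If `x` were in `R`, it would be a fixed point of its own action.
  have hx1 : (x : G ⧸ fittingSubgroup G) ≠ 1 := fun h => by
    have := hfix x ((QuotientGroup.eq_one_iff x).1 h) (mul_inv_cancel_right x x)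
    rw [this, orderOf_one] at hx
    omega
  have hmem := AltFive.mem_of_pow_five_eq_one _ e
    (centralizer_generalizedFittingSubgroup_eq_bot hcenter) hx5
  obtain ⟨f, hf⟩ := AltFive.exists_hom_rot_eq _ e hmem hx5 hx1
  have hr2 : r ≠ 2 := by
    rintro rfl
    exact absurd hr_odd (by decide)
  exact LowerCentral.term_two_eq_bot_of_fixedPointFree hr hr2 hr5 hp hfix f hf
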